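/- The monadic second-order language of order has element variables, set variables, the atomic formulas $x<y$, $x=y$ and $x\in X$, Boolean connectives, and quantification over elements and over arbitrary subsets. For ordinals $\alpha,\beta$ write $\alpha\to\beta$ if there are a formula $\varphi(x,y,X_0,\dots,X_{k-1})$ of this language (for some finite $k$) and subsets $P_0,\dots,P_{k-1}\subseteq\alpha$ such that the relation $$x<^*y \iff (\alpha,<)\models\varphi(x,y,P_0,\dots,P_{k-1})$$ is a (strict) well-ordering of the set of all elements of $\alpha$ of order type $\beta$. For every ordinal $\alpha>0$, $\alpha\not\to\alpha\cdot\omega$. (Here $\alpha\cdot\omega$ is the ordinal product, i.e. the order type of $\omega$ consecutive copies of $\alpha$.) -/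

import Mathlib

open scoped Ordinal

universe u

/-- Formulas of the monadic second-order language of order `{<}`, with free element variables
`x₀, …, x₍ₙ₋₁₎` and free set variables `X₀, …, X₍ₖ₋₁₎`.  A quantifier binds the last variable of
its sort. -/
inductive MonadicFormula : ℕ → ℕ → Type
  | falsum {n k : ℕ} : MonadicFormula n k
  | lt {n k : ℕ} (i j : Fin n) : MonadicFormula n k
  | eq {n k : ℕ} (i j : Fin n) : MonadicFormula n k
  | mem {n k : ℕ} (i : Fin n) (s : Fin k) : MonadicFormula n k
  | imp {n k : ℕ} (φ ψ : MonadicFormula n k) : MonadicFormula n k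
  | allElem {n k : ℕ} (φ : MonadicFormula (n + 1) k) : MonadicFormula n k
  | allSet {n k : ℕ} (φ : MonadicFormula n (k + 1)) : MonadicFormula n k

/-- Satisfaction of a monadic formula in an ordered set `M`: element variables range over `M`,
set variables over all subsets of `M`. -/
def MonadicFormula.Realize {M : Type*} [LT M] :
    {n k : ℕ} → MonadicFormula n k → (Fin n → M) → (Fin k → Set M) → Prop
  | _, _, .falsum, _, _ => False
  | _, _, .lt i j, v, _ => v i < v j
  | _, _, .eq i j, v, _ => v i = v j
  | _, _, .mem i s, v, V => v i ∈ V s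
  | _, _, .imp φ ψ, v, V => φ.Realize v V → ψ.Realize v V
  | _, _, .allElem φ, v, V => ∀ a : M, φ.Realize (Fin.snoc v a) V
  | _, _, .allSet φ, v, V => ∀ A : Set M, φ.Realize v (Fin.snoc V A)

/-- `α → β`: some monadic formula `φ(x, y, P̄)` with a finite tuple `P̄` of subsets of `α` as
parameters defines in `(α, <)` a (strict) well-ordering of the elements of `α` whose order type
is `β`. -/
def Ordinal.MonadicArrow (α β : Ordinal.{u}) : Prop :=
  ∃ (k : ℕ) (φ : MonadicFormula 2 k) (P : Fin k → Set α.ToType)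
    (_ : IsWellOrder α.ToType fun x y => φ.Realize ![x, y] P),
    Ordinal.type (fun x y : α.ToType => φ.Realize ![x, y] P) = β

/-! For elements on opposite sides of a cut of `α`, the defined order depends only on a type of the
lower element and a type of the upper one, from a finite set `T` independent of the cut
(`MonadicFormula.exists_finite_types`). Listing `α` in order type `α * ω` gives an injection `f`
from `α * ω` into `α`. By `hasAlternation_of_injOn`, some cut is crossed along `a 0 < b 0 < a 1 < b
1 < ⋯` more than `|T|` times, each `f (a j)` below it and each `f (b j)` above. Two of the lower
elements, of indices `i < j`, share a type, so `a i < b i` forces `a j < b i`, which is absurd. -/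

/-- The valuation that follows `v` on the variables in `s` and `w` on the others. -/
noncomputable def mixElem {M : Type*} {n : ℕ} (s : Fin n → Prop) (v w : Fin n → M) : Fin n → M :=
  open Classical in fun i => if s i then v i else w i

/-- The set valuation that agrees with `V` on `C` and with `W` off `C`. -/
def mixSet {M : Type*} {k : ℕ} (C : Set M) (V W : Fin k → Set M) : Fin k → Set M :=
  fun j => C.ite (V j) (W j)

theorem snoc_prop_castSucc {n : ℕ} (s : Fin n → Prop) (p : Prop) (i : Fin n) :
    (Fin.snoc s p : Fin (n + 1) → Prop) i.castSucc = s i :=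
  Fin.snoc_castSucc (α := fun _ => Prop) p s i

theorem mixElem_snoc_true {M : Type*} {n : ℕ} (s : Fin n → Prop) (v w : Fin n → M) (a b : M) :
    mixElem (Fin.snoc s True : Fin (n + 1) → Prop) (Fin.snoc v a) (Fin.snoc w b) =
      Fin.snoc (mixElem s v w) a := by
  classical
  funext i
  refine Fin.lastCases (by simp [mixElem]) (fun i => ?_) i
  simp only [mixElem, Fin.snoc_castSucc (α := fun _ => M)]
  exact if_congr (iff_of_eq (snoc_prop_castSucc s True i)) rfl rfl

theorem mixElem_snoc_false {M : Type*} {n : ℕ} (s : Fin n → Prop) (v w : Fin n → M) (a b : M) :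
    mixElem (Fin.snoc s False : Fin (n + 1) → Prop) (Fin.snoc v a) (Fin.snoc w b) =
      Fin.snoc (mixElem s v w) b := by
  classical
  funext i
  refine Fin.lastCases (by simp [mixElem]) (fun i => ?_) i
  simp only [mixElem, Fin.snoc_castSucc (α := fun _ => M)]
  exact if_congr (iff_of_eq (snoc_prop_castSucc s False i)) rfl rfl

theorem mixSet_snoc {M : Type*} {k : ℕ} (C : Set M) (V W : Fin k → Set M) (A B : Set M) :
    mixSet C (Fin.snoc V A : Fin (k + 1) → Set M) (Fin.snoc W B) =
      Fin.snoc (mixSet C V W) (C.ite A B) := by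
  funext i
  refine Fin.lastCases ?_ (fun i => ?_) i <;> simp [mixSet]

theorem mixSet_self {M : Type*} {k : ℕ} (C : Set M) (V : Fin k → Set M) : mixSet C V V = V := by
  funext i
  simp [mixSet]

/-- Composition theorem for monadic formulas in an ordered sum: there are finitely many types of
valuations, their number not depending on the cut `C`, such that the truth of `φ` is determined by
the type of the part of the valuation below the cut and the type of the part above it. -/
theorem MonadicFormula.exists_finite_types {M : Type*} [LinearOrder M] {n k : ℕ}
    (φ : MonadicFormula n k) :
    ∃ T : Type, Finite T ∧ ∀ C : Set M, (∀ x ∈ C, ∀ y ∉ C, x < y) → ∀ s : Fin n → Prop,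
      ∃ (tL tR : (Fin n → M) → (Fin k → Set M) → T) (ρ : T → T → Prop),
        ∀ v w V W, (∀ i, s i → v i ∈ C) → (∀ i, ¬ s i → w i ∉ C) →
          (φ.Realize (mixElem s v w) (mixSet C V W) ↔ ρ (tL v V) (tR w W)) := by
  classical
  induction φ with
  | falsum =>
    exact ⟨Unit, inferInstance, fun C _ s => ⟨fun _ _ => (), fun _ _ => (), fun _ _ => False,
      fun v w V W _ _ => Iff.rfl⟩⟩
  | lt i j =>
    refine ⟨Prop, inferInstance, fun C hC s => ⟨fun v _ => v i < v j, fun w _ => w i < w j,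
      fun p q => if s i then (s j → p) else (¬ s j ∧ q), fun v w V W hv hw => ?_⟩⟩
    by_cases hi : s i <;> by_cases hj : s j <;> simp only [Realize, mixElem, hi, hj, if_true,
      if_false, forall_const, not_true, not_false_iff, false_and, true_and, false_imp_iff, iff_true,
      iff_false, not_lt]
    · exact hC _ (hv i hi) _ (hw j hj)
    · exact (hC _ (hv j hj) _ (hw i hi)).le
  | eq i j =>
    refine ⟨Prop, inferInstance, fun C hC s => ⟨fun v _ => v i = v j, fun w _ => w i = w j,
      fun p q => if s i then (s j ∧ p) else (¬ s j ∧ q), fun v w V W hv hw => ?_⟩⟩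
    by_cases hi : s i <;> by_cases hj : s j <;> simp only [Realize, mixElem, hi, hj, if_true,
      if_false, not_true, not_false_iff, false_and, true_and, iff_false]
    · exact (hC _ (hv i hi) _ (hw j hj)).ne
    · exact (hC _ (hv j hj) _ (hw i hi)).ne'
  | mem i j =>
    refine ⟨Prop, inferInstance, fun C hC s => ⟨fun v V => v i ∈ V j, fun w W => w i ∈ W j,
      fun p q => if s i then p else q, fun v w V W hv hw => ?_⟩⟩
    by_cases hi : s i
    · simp [Realize, mixElem, mixSet, hi, Set.ite, hv i hi]
    · simp [Realize, mixElem, mixSet, hi, Set.ite, hw i hi]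
  | imp φ ψ ihφ ihψ =>
    obtain ⟨T₁, _, h₁⟩ := ihφ
    obtain ⟨T₂, _, h₂⟩ := ihψ
    refine ⟨T₁ × T₂, inferInstance, fun C hC s => ?_⟩
    obtain ⟨l₁, r₁, ρ₁, e₁⟩ := h₁ C hC s
    obtain ⟨l₂, r₂, ρ₂, e₂⟩ := h₂ C hC s
    exact ⟨fun v V => (l₁ v V, l₂ v V), fun v V => (r₁ v V, r₂ v V),
      fun p q => ρ₁ p.1 q.1 → ρ₂ p.2 q.2, fun v w V W hv hw => by
        simp only [Realize, e₁ v w V W hv hw, e₂ v w V W hv hw]⟩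
  | allElem φ ih =>
    obtain ⟨T, _, h⟩ := ih
    -- The new element lies in `C` (first component) or off `C` (second). A side records the types
    -- attainable there; on the side not containing the element its value is a dummy.
    refine ⟨Set T × Set T, inferInstance, fun C hC s => ?_⟩
    obtain ⟨l₁, r₁, ρ₁, e₁⟩ := h C hC (Fin.snoc s True)
    obtain ⟨l₂, r₂, ρ₂, e₂⟩ := h C hC (Fin.snoc s False)
    refine ⟨fun v V => ({t | ∃ a ∈ C, l₁ (Fin.snoc v a) V = t}, {t | ∃ a, l₂ (Fin.snoc v a) V = t}),
      fun w W => ({t | ∃ b, r₁ (Fin.snoc w b) W = t}, {t | ∃ b ∉ C, r₂ (Fin.snoc w b) W = t}),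
      fun p q => (∀ t ∈ p.1, ∀ u ∈ q.1, ρ₁ t u) ∧ (∀ t ∈ p.2, ∀ u ∈ q.2, ρ₂ t u),
      fun v w V W hv hw => ?_⟩
    have k₁ : ∀ a ∈ C, ∀ b, φ.Realize (Fin.snoc (mixElem s v w) a) (mixSet C V W) ↔
        ρ₁ (l₁ (Fin.snoc v a) V) (r₁ (Fin.snoc w b) W) := fun a ha b => by
      rw [← e₁, mixElem_snoc_true]
      · exact fun i => Fin.lastCases (by simpa) (fun i => by simpa using hv i) i
      · exact fun i => Fin.lastCases (by simp) (fun i => by simpa using hw i) i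
    have k₂ : ∀ a, ∀ b ∉ C, φ.Realize (Fin.snoc (mixElem s v w) b) (mixSet C V W) ↔
        ρ₂ (l₂ (Fin.snoc v a) V) (r₂ (Fin.snoc w b) W) := fun a b hb => by
      rw [← e₂, mixElem_snoc_false]
      · exact fun i => Fin.lastCases (by simp) (fun i => by simpa using hv i) i
      · exact fun i => Fin.lastCases (by simpa) (fun i => by simpa using hw i) i
    simp only [Realize, Set.mem_ofPred_eq]
    constructor
    · refine fun H => ⟨?_, ?_⟩
      · rintro _ ⟨a, ha, rfl⟩ _ ⟨b, rfl⟩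
        exact (k₁ a ha b).1 (H a)
      · rintro _ ⟨a, rfl⟩ _ ⟨b, hb, rfl⟩
        exact (k₂ a b hb).1 (H b)
    · rintro ⟨H₁, H₂⟩ a
      by_cases ha : a ∈ C
      · exact (k₁ a ha a).2 (H₁ _ ⟨a, ha, rfl⟩ _ ⟨a, rfl⟩)
      · exact (k₂ a a ha).2 (H₂ _ ⟨a, rfl⟩ _ ⟨a, ha, rfl⟩)
  | allSet φ ih =>
    obtain ⟨T, _, h⟩ := ih
    refine ⟨Set T, inferInstance, fun C hC s => ?_⟩
    obtain ⟨l, r, ρ, e⟩ := h C hC s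
    refine ⟨fun v V => {t | ∃ A, l v (Fin.snoc V A) = t}, fun w W => {t | ∃ B, r w (Fin.snoc W B) = t},
      fun p q => ∀ t ∈ p, ∀ u ∈ q, ρ t u, fun v w V W hv hw => ?_⟩
    simp only [Realize, Set.mem_ofPred_eq]
    constructor
    · rintro H _ ⟨A, rfl⟩ _ ⟨B, rfl⟩
      rw [← e _ _ _ _ hv hw, mixSet_snoc]
      exact H _
    · intro H A
      have := H _ ⟨A, rfl⟩ _ ⟨A, rfl⟩
      rwa [← e _ _ _ _ hv hw, mixSet_snoc, Set.ite_same] at this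

/-! ### Injections of `α * ω` into `α` and alternation -/

/-- Some cut `δ` of the values of `f` is crossed by an increasing sequence of length `2 * N` below
`β`, alternately from below and from above. -/
def HasAlternation (f : Ordinal.{u} → Ordinal.{u}) (β : Ordinal.{u}) (N : ℕ) : Prop :=
  ∃ (δ : Ordinal.{u}) (a b : ℕ → Ordinal.{u}), ∀ j < N,
    a j < b j ∧ b j < β ∧ f (a j) < δ ∧ δ ≤ f (b j) ∧ ∀ i < j, b i < a j

theorem HasAlternation.of_shift {f : Ordinal.{u} → Ordinal.{u}} {x₀ ε β' β : Ordinal.{u}} {N : ℕ}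
    (hβ : ∀ x < β', x₀ + x < β) (hε : ∀ x < β', ε ≤ f (x₀ + x))
    (h : HasAlternation (fun x => f (x₀ + x) - ε) β' N) : HasAlternation f β N := by
  obtain ⟨δ, a, b, H⟩ := h
  refine ⟨ε + δ, fun j => x₀ + a j, fun j => x₀ + b j, fun j hj => ?_⟩
  obtain ⟨h1, h2, h3, h4, h5⟩ := H j hj
  have ea := Ordinal.add_sub_cancel_of_le (hε _ (h1.trans h2))
  have eb := Ordinal.add_sub_cancel_of_le (hε _ h2)
  refine ⟨by simpa using h1, hβ _ h2, ?_, ?_, fun i hi => by simpa using h5 i hi⟩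
  · rw [← ea]; simpa using h3
  · rw [← eb]; simpa using h4

/-- If values on both sides of `δ` recurred cofinally, choosing them in turn would give alternations
of every length. -/
theorem eventually_lt_or_le_of_not_hasAlternation {f : Ordinal.{u} → Ordinal.{u}} {β : Ordinal.{u}}
    {N : ℕ} (h0 : 0 < β) (h : ¬ HasAlternation f β N) (δ : Ordinal.{u}) :
    (∃ x₀ < β, ∀ x, x₀ < x → x < β → f x < δ) ∨ (∃ x₀ < β, ∀ x, x₀ < x → x < β → δ ≤ f x) := by
  by_contra! hc
  obtain ⟨h1, h2⟩ := hc
  choose! R hR using h1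
  choose! L hL using h2
  let a : ℕ → Ordinal.{u} := fun j => Nat.rec (L 0) (fun _ x => L (R x)) j
  have ha : ∀ j, a j < β ∧ f (a j) < δ := by
    intro j
    induction j with
    | zero => exact (hL 0 h0).2
    | succ j ih => exact (hL _ (hR _ ih.1).2.1).2
  have hs : ∀ j, R (a j) < a (j + 1) := fun j => (hL _ (hR _ (ha j).1).2.1).1
  have hm : StrictMono a := strictMono_nat_of_lt_succ fun j => (hR _ (ha j).1).1.trans (hs j)
  exact h ⟨δ, a, fun j => R (a j), fun j _ => ⟨(hR _ (ha j).1).1, (hR _ (ha j).1).2.1, (ha j).2,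
    (hR _ (ha j).1).2.2, fun i hi => (hs i).trans_le (hm.monotone hi)⟩⟩

theorem Ordinal.add_lt_mul_omega0 {α x y : Ordinal.{u}} (hx : x < α * ω) (hy : y < α * ω) :
    x + y < α * ω := by
  rw [Ordinal.lt_mul_iff_of_isSuccLimit Ordinal.isSuccLimit_omega0] at hx hy
  obtain ⟨p, hp, hx⟩ := hx
  obtain ⟨q, hq, hy⟩ := hy
  calc x + y < α * p + α * q := by
        exact (add_le_add_left hx.le y).trans_lt (add_lt_add_right hy _)
    _ = α * (p + q) := (mul_add _ _ _).symm
    _ ≤ α * ω := mul_le_mul_right (Ordinal.isPrincipal_add_omega0 hp hq).le _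

/-- An injection from `α * ω` into `α` crosses cuts of `α` arbitrarily many times. -/
theorem hasAlternation_of_injOn (N : ℕ) (α : Ordinal.{u}) (hα : α ≠ 0)
    (f : Ordinal.{u} → Ordinal.{u}) (hf : Set.InjOn f (Set.Iio (α * ω)))
    (hlt : ∀ x < α * ω, f x < α) : HasAlternation f (α * ω) N := by
  induction α using WellFoundedLT.induction generalizing f with
  | ind α ih =>
  by_contra hN
  have h0 : 0 < α * ω := mul_pos (pos_iff_ne_zero.2 hα) Ordinal.omega0_pos
  have hωle : ω ≤ α * ω := le_mul_of_one_le_left' (Order.one_le_iff_ne_zero.2 hα)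
  have h1ω : 1 < α * ω := Ordinal.one_lt_omega0.trans_le hωle
  have hα1 : α ≠ 1 := by
    rintro rfl
    have e0 := Order.lt_one_iff.1 (hlt 0 h0)
    have e1 := Order.lt_one_iff.1 (hlt 1 h1ω)
    exact zero_ne_one (hf h0 h1ω (e0.trans e1.symm))
  -- The induction hypothesis forbids squeezing a translate of `α' * ω` into an interval of length
  -- `α' < α`.
  have shift : ∀ α' < α, α' ≠ 0 → ∀ x₀ < α * ω, ∀ ε,
      (∀ x < α' * ω, ε ≤ f (x₀ + x) ∧ f (x₀ + x) < ε + α') → False := by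
    intro α' hα' h0' x₀ hx₀ ε H
    have hle : ∀ x < α' * ω, x₀ + x < α * ω := fun x hx =>
      Ordinal.add_lt_mul_omega0 hx₀ (hx.trans_le (mul_le_mul_left hα'.le _))
    refine hN (HasAlternation.of_shift hle (fun x hx => (H x hx).1)
      (ih α' hα' h0' _ ?_ fun x hx => ?_))
    · intro x hx y hy hxy
      have e := congrArg (ε + ·) hxy
      simp only [Ordinal.add_sub_cancel_of_le (H x hx).1,
        Ordinal.add_sub_cancel_of_le (H y hy).1] at e
      simpa using hf (hle x hx) (hle y hy) e
    · rw [Ordinal.sub_lt_of_le (H x hx).1]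
      exact (H x hx).2
  have interval : ∀ α' < α, ∀ x₀ < α * ω, ∀ ε,
      (∀ x, x₀ < x → x < α * ω → ε ≤ f x ∧ f x < ε + α') → False := by
    intro α' hα' x₀ hx₀ ε H
    have hx₁ := Ordinal.add_lt_mul_omega0 hx₀ h1ω
    have hx₀₁ : x₀ < x₀ + 1 := lt_add_one x₀
    refine shift α' hα' ?_ (x₀ + 1) hx₁ ε fun x hx => H _ (hx₀₁.trans_le (le_add_right le_rfl))
      (Ordinal.add_lt_mul_omega0 hx₁ (hx.trans_le (mul_le_mul_left hα'.le _)))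
    rintro rfl
    have := H _ hx₀₁ hx₁
    simp only [add_zero] at this
    exact this.2.not_ge this.1
  have cofinal : ∀ ε < α, ∃ x₀ < α * ω, ∀ x, x₀ < x → x < α * ω → ε ≤ f x := by
    intro ε hε
    refine (eventually_lt_or_le_of_not_hasAlternation h0 hN ε).resolve_left ?_
    rintro ⟨x₀, hx₀, H⟩
    exact interval ε hε x₀ hx₀ 0 fun x h h' => ⟨zero_le, by simpa using H x h h'⟩
  -- Values are eventually at least `ε`, so the remainder `α - ε` cannot be shorter than `α`: `α` is
  -- additively indecomposable.
  have absorb : ∀ ε < α, ε + α = α := by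
    intro ε hε
    obtain ⟨x₀, hx₀, H⟩ := cofinal ε hε
    have e := Ordinal.add_sub_cancel_of_le hε.le
    rcases (Ordinal.sub_le_self α ε).lt_or_eq with h | h
    · exact (interval _ h x₀ hx₀ ε fun x hx hx' => ⟨H x hx hx', e.symm ▸ hlt x hx'⟩).elim
    · rwa [h] at e
  have succ_lt : ∀ x < α, x + 1 < α := by
    intro x hx
    refine (Order.add_one_le_of_lt hx).lt_of_ne fun h => hα1 ?_
    have := absorb x hx
    nth_rw 2 [← h] at this
    exact add_left_cancel this
  have block : ∀ j : ℕ, ∀ x < α, α * j + x < α * ω := fun j x hx =>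
    Ordinal.add_lt_mul_omega0 (by gcongr; exact Ordinal.natCast_lt_omega0 j)
      (hx.trans_le (le_mul_of_one_le_right' Ordinal.one_lt_omega0.le))
  -- If `f` were unbounded on every block, a `δ` above the values at the first `N` block starts
  -- would be crossed once in each of these blocks.
  obtain ⟨j, ε, hε, hj⟩ : ∃ j : ℕ, ∃ ε < α, ∀ x < α, f (α * j + x) < ε := by
    by_contra! hb
    obtain ⟨δ, hδ, hδf⟩ : ∃ δ < α, ∀ j < N, f (α * j) < δ := by
      clear hN ih shift interval cofinal
      induction N with
      | zero => exact ⟨0, pos_iff_ne_zero.2 hα, by simp⟩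
      | succ N ih =>
        obtain ⟨δ, hδ, H⟩ := ih
        have hN := hlt _ (by simpa using block N 0 (pos_iff_ne_zero.2 hα))
        refine ⟨max δ (f (α * N) + 1), max_lt hδ (succ_lt _ hN), fun j hj => ?_⟩
        rcases Nat.lt_succ_iff_lt_or_eq.1 hj with h | rfl
        · exact (H j h).trans_le (le_max_left _ _)
        · exact (lt_add_one _).trans_le (le_max_right _ _)
    choose b hb hbf using fun j => hb j δ hδ
    refine hN ⟨δ, fun j => α * j, fun j => α * j + b j, fun j hj => ⟨?_, block j _ (hb j),
      hδf j hj, hbf j, fun i hi => ?_⟩⟩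
    · refine lt_of_le_of_ne (le_add_right le_rfl) fun h => ?_
      exact ((hδf j hj).trans_le (hbf j)).ne (congrArg f h)
    · calc α * i + b i < α * i + α := add_lt_add_right (hb i) _
        _ = α * ((i + 1 : ℕ) : Ordinal) := by push_cast; rw [mul_add, mul_one]
        _ ≤ α * j := by gcongr; exact hi
  -- By indecomposability the bounded block contains a copy of `ε * ω`, which `f` sends below `ε`.
  have hεα : ε * ω ≤ α := by
    refine (Ordinal.mul_le_iff_of_isSuccLimit Ordinal.isSuccLimit_omega0).2 fun m hm => ?_
    obtain ⟨m, rfl⟩ := Ordinal.lt_omega0.1 hm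
    suffices ε * m + α = α by rw [← this]; exact le_add_right le_rfl
    clear hm
    induction m with
    | zero => simp
    | succ m ihm => push_cast; rw [mul_add, mul_one, add_assoc, absorb ε hε, ihm]
  refine shift ε hε ?_ (α * j) (by simpa using block j 0 (pos_iff_ne_zero.2 hα)) 0 fun x hx =>
    ⟨zero_le, by simpa using hj x (hx.trans_le hεα)⟩
  rintro rfl
  exact not_lt_zero (hj 0 (pos_iff_ne_zero.2 hα))

theorem lemma4p5 (α : Ordinal.{u}) (hα : α ≠ 0) : ¬ α.MonadicArrow (α * ω) := by
  rintro ⟨k, φ, P, hwo, htype⟩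
  obtain ⟨T, _, hT⟩ := φ.exists_finite_types (M := α.ToType)
  set r : α.ToType → α.ToType → Prop := fun x y => φ.Realize ![x, y] P with hr
  let g : Set.Iio (α * ω) → α.ToType := fun x =>
    Ordinal.enum r ⟨x.1, by have := x.2; rw [htype]; exact this⟩
  have hg : ∀ x y, r (g x) (g y) ↔ x < y := fun x y => by
    exact (Ordinal.enum r).map_rel_iff
  let F : α.ToType → Ordinal.{u} := fun m => Ordinal.typein (α := α.ToType) (· < ·) m
  have hF : ∀ x y, F x < F y ↔ x < y := fun x y => Ordinal.typein_lt_typein (α := α.ToType) (· < ·)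
  classical
  let f : Ordinal.{u} → Ordinal.{u} := fun x => if h : x < α * ω then F (g ⟨x, h⟩) else 0
  have hfg : ∀ x (h : x < α * ω), f x = F (g ⟨x, h⟩) := fun x h => dif_pos h
  obtain ⟨δ, a, b, H⟩ := hasAlternation_of_injOn (Nat.card T + 1) α hα f
    (fun x hx y hy hxy => by
      rw [hfg x hx, hfg y hy] at hxy
      have := Ordinal.typein_injective _ hxy
      have := Ordinal.enum_inj.1 this
      exact congrArg Subtype.val this)
    (fun x hx => by rw [hfg x hx]; exact Ordinal.typein_lt_self _)
  have hC : ∀ x ∈ {m | F m < δ}, ∀ y ∉ {m | F m < δ}, x < y := fun x hx y hy =>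
    (hF x y).1 (lt_of_lt_of_le hx (not_lt.1 hy))
  obtain ⟨l, t, ρ, e⟩ := hT {m | F m < δ} hC ![True, False]
  have hb : ∀ j : Fin (Nat.card T + 1), b j < α * ω := fun j => (H j j.2).2.1
  have ha : ∀ j : Fin (Nat.card T + 1), a j < α * ω := fun j => (H j j.2).1.trans (hb j)
  -- Each valuation repeats one element because `mixElem` reads only coordinate 0 of the lower one
  -- and coordinate 1 of the upper one.
  have key : ∀ i j : Fin (Nat.card T + 1), a i < b j ↔
      ρ (l ![g ⟨a i, ha i⟩, g ⟨a i, ha i⟩] P) (t ![g ⟨b j, hb j⟩, g ⟨b j, hb j⟩] P) := by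
    intro i j
    have hm : mixElem ![True, False] ![g ⟨a i, ha i⟩, g ⟨a i, ha i⟩] ![g ⟨b j, hb j⟩, g ⟨b j, hb j⟩]
        = ![g ⟨a i, ha i⟩, g ⟨b j, hb j⟩] := by
      funext c; fin_cases c <;> simp [mixElem]
    rw [← e, mixSet_self, hm]
    · exact (hg ⟨a i, ha i⟩ ⟨b j, hb j⟩).symm
    · intro c; fin_cases c <;> simp [← hfg, (H i i.2).2.2.1]
    · intro c; fin_cases c <;> simp [← hfg, (H j j.2).2.2.2.1]
  have := Fintype.ofFinite T
  obtain ⟨i, j, hij, hl⟩ := Fintype.exists_ne_map_eq_of_card_lt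
    (fun i : Fin (Nat.card T + 1) => l ![g ⟨a i, ha i⟩, g ⟨a i, ha i⟩] P) (by simp)
  have main : ∀ i j : Fin (Nat.card T + 1), i < j →
      l ![g ⟨a i, ha i⟩, g ⟨a i, ha i⟩] P = l ![g ⟨a j, ha j⟩, g ⟨a j, ha j⟩] P → False := by
    intro i j hij hl
    have h1 := (key i i).1 (H i i.2).1
    rw [hl, ← key] at h1
    exact h1.not_gt ((H j j.2).2.2.2.2 i hij)
  rcases hij.lt_or_gt with h | h
  · exact main i j h hl
  · exact main j i h hl.symm
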